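/- Let $G$ be a locally compact, $\sigma$-compact, metrizable topological group, $\Gamma\subset G$ a discrete subgroup, and $X=G/\Gamma$. Suppose that $X$ admits a Haar measure $m_X$, i.e. a nonzero $G$-invariant Radon measure, and that $X$ has at most quadratic growth: there exist a relatively compact neighborhood $V$ of the identity in $G$ which generates $G$, in the sense that $G=\bigcup_{n\ge 1}V^n$, and a point $x\in X$ such that $$\limsup_{n\to\infty}\frac{m_X(V^n x)}{n^2}<\infty .$$ Let $\mu$ be a Borel probability measure on $G$ with compact support that is symmetric ($\mu(B)=\mu(B^{-1})$ for all Borel sets $B\subset G$), adapted (the closed subgroup generated by $\operatorname{supp}(\mu)$ is $G$) and spread out (for some $n_0\ge 1$ the convolution power $\mu^{*n_0}$ is not singular with respect to Haar measure on $G$). Then the random walk on $X$ given by $\mu$ is topologically Harris recurrent: if $(Y_k)_{k\ge1}$ are i.i.d. random variables in $G$ with law $\mu$, then for every $x\in X$ and every neighborhood $B$ of $x$, almost surely $Y_n\cdots Y_1x\in B$ for infinitely many $n$. -/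

import Mathlib

open MeasureTheory Filter Topology
open scoped Pointwise ENNReal

namespace HomogeneousWalk

/-- Convolution powers of a measure on a group: the zeroth power is the Dirac mass at `1`. -/
noncomputable def convPow {G : Type*} [Group G] [MeasurableSpace G] (μ : Measure G) :
    ℕ → Measure G
  | 0 => Measure.dirac 1
  | n + 1 => Measure.mconv μ (convPow μ n)

/-- `μ` is spread out: some convolution power `μ^{*n}`, `n ≥ 1`, is not singular with respect to
Haar measure on `G`. -/
def IsSpreadOut {G : Type*} [Group G] [TopologicalSpace G] [IsTopologicalGroup G]
    [LocallyCompactSpace G] [MeasurableSpace G] [BorelSpace G] (μ : Measure G) : Prop :=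
  ∃ n : ℕ, 1 ≤ n ∧ ¬ (convPow μ n).MutuallySingular Measure.haar

/-- `μ` is adapted: the closed subgroup generated by its support is all of `G`. -/
def IsAdapted {G : Type*} [Group G] [TopologicalSpace G] [IsTopologicalGroup G]
    [MeasurableSpace G] (μ : Measure G) : Prop :=
  (Subgroup.closure μ.support).topologicalClosure = ⊤

/-- `μ` is symmetric: `μ(B) = μ(B⁻¹)` for every measurable set `B`. -/
def IsSymmetric {G : Type*} [Group G] [MeasurableSpace G] (μ : Measure G) : Prop :=
  ∀ B : Set G, MeasurableSet B → μ B = μ B⁻¹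

/-- A Haar measure on a `G`-space `X`: a nonzero `G`-invariant Radon measure. -/
structure IsHaarOn (G : Type*) {X : Type*} [Group G] [MulAction G X] [TopologicalSpace X]
    [MeasurableSpace X] (m : Measure X) : Prop where
  ne_zero : m ≠ 0
  regular : m.Regular
  invariant : SMulInvariantMeasure G X m

/-- `X`, with the Haar measure `m`, has polynomial growth of degree at most `d`: there are a
relatively compact neighborhood `V` of the identity in `G` that generates `G` (every element of `G`
is a finite product of elements of `V`) and a point `x` with `limsup m(Vⁿ x) / n ^ d < ∞`. -/
def HasPolynomialGrowth (G : Type*) {X : Type*} [Group G] [TopologicalSpace G] [MulAction G X]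
    [MeasurableSpace X] (m : Measure X) (d : ℕ) : Prop :=
  ∃ V ∈ 𝓝 (1 : G), IsCompact (closure V) ∧ Submonoid.closure V = ⊤ ∧
    ∃ x : X, limsup (fun n : ℕ => m ((fun g : G => g • x) '' (V ^ n)) / (n : ℝ≥0∞) ^ d) atTop < ∞

/-- The position `Φₙ = Yₙ ⋯ Y₁ x` of the walk after `n` steps, where `Yₖ₊₁ = Y k`. -/
def walk {G X : Type*} [Group G] [MulAction G X] (x : X) (Y : ℕ → G) : ℕ → X
  | 0 => x
  | n + 1 => Y n • walk x Y n

/-- The state `x` is topologically Harris recurrent for the walk on `X` whose increments are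
i.i.d. with law `μ`: almost surely, the walk started at `x` visits each given neighborhood of `x`
infinitely often. -/
def IsTopHarrisRecurrentAt {G X : Type*} [Group G] [MeasurableSpace G] [MulAction G X]
    [TopologicalSpace X] (μ : Measure G) [IsProbabilityMeasure μ] (x : X) : Prop :=
  ∀ B ∈ 𝓝 x, ∀ᵐ Y ∂(Measure.infinitePi fun _ : ℕ => μ), ∃ᶠ n in atTop, walk x Y n ∈ B

/-- The random walk on `X` given by `μ` is topologically Harris recurrent: every state is. -/
def IsTopHarrisRecurrent {G : Type*} (X : Type*) [Group G] [MeasurableSpace G] [MulAction G X]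
    [TopologicalSpace X] (μ : Measure G) [IsProbabilityMeasure μ] : Prop :=
  ∀ x : X, IsTopHarrisRecurrentAt μ x

/-- The quotient `σ`-algebra that Mathlib puts on `G ⧸ Γ` is the Borel `σ`-algebra. -/
theorem borelSpace_quotient {G : Type*} [Group G] [TopologicalSpace G] [IsTopologicalGroup G]
    [LocallyCompactSpace G] [SigmaCompactSpace G] [TopologicalSpace.MetrizableSpace G]
    [MeasurableSpace G] [BorelSpace G] (Γ : Subgroup G) [DiscreteTopology Γ] :
    BorelSpace (G ⧸ Γ) := by
  have : SecondCountableTopology G := by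
    let _ := TopologicalSpace.metrizableSpaceMetric G
    exact EMetric.secondCountable_of_sigmaCompact G
  have : PolishSpace G := by
    let _ := IsTopologicalGroup.rightUniformSpace G
    have : (uniformity G).IsCountablyGenerated :=
      inferInstanceAs ((comap (fun p : G × G => p.2 * p.1⁻¹) (𝓝 1)).IsCountablyGenerated)
    have : IsRightUniformGroup G := ⟨rfl⟩
    have : CompleteSpace G := IsRightUniformGroup.completeSpace_of_weaklyLocallyCompactSpace
    have : TopologicalSpace.IsCompletelyMetrizableSpace G := inferInstance
    infer_instance
  have hc : IsClosed (Γ : Set G) := Subgroup.isClosed_of_discrete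
  have : T1Space (G ⧸ Γ) := inferInstance
  exact ⟨QuotientGroup.continuous_mk.map_eq_borel QuotientGroup.mk_surjective⟩

end HomogeneousWalk

/-! The argument is potential-theoretic. Let `q x` be the probability of never visiting an open set
`B` from `x`. Never visiting from time 0 on implies never visiting from time 1 on, so `q` is
subharmonic and `f = 2 - q` is a positive superharmonic function. By symmetry of `μ` the walk is
reversible for `m`, and a Hardy-type inequality (`lintegral_superharmonic_le_energy`) bounds a
weighted energy of `u / f` by the energy of `u`. Quadratic growth supplies logarithmic cutoffs `u`
tending to 1 with energy tending to 0 (`tendsto_energy_logCutoff`), so Fatou's lemma forces `f (g •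
x) = f x` almost everywhere.

The elements of `G` fixing `f` modulo null sets then form a subgroup of full `μ`-measure.
Spread-outness makes it open and adaptedness makes it all of `G` (`aeStabilizer_eq_top`), so `f` is
almost everywhere constant. Since `q = 0` on `B`, which has positive measure, `q = 0` almost
everywhere.

Hence the probability of finitely many visits vanishes almost everywhere. It is a bounded harmonic
function, and spread-outness upgrades this to every starting point (`harmonic_eq_zero_of_ae`). -/

namespace HomogeneousWalk

/-! ### Markov property at time one; avoidance and escape probabilities -/

section Shift

/-- The sequence with first term `p.1`, followed by the terms of `p.2`. -/
def consSeq {G : Type*} (p : G × (ℕ → G)) : ℕ → G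
  | 0 => p.1
  | n + 1 => p.2 n

theorem measurable_consSeq {G : Type*} [MeasurableSpace G] :
    Measurable (consSeq : G × (ℕ → G) → ℕ → G) := by
  refine measurable_pi_iff.2 fun n => ?_
  cases n with
  | zero => exact measurable_fst
  | succ n => exact (measurable_pi_apply n).comp measurable_snd

theorem map_consSeq {G : Type*} [MeasurableSpace G] (μ : Measure G) [IsProbabilityMeasure μ] :
    (μ.prod (Measure.infinitePi fun _ : ℕ => μ)).map consSeq =
      Measure.infinitePi fun _ : ℕ => μ := by
  classical
  refine Measure.eq_infinitePi _ fun s t ht => ?_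
  obtain ⟨N, hN⟩ : ∃ N, s ⊆ Finset.range (N + 1) :=
    ⟨s.sup id, fun i hi => Finset.mem_range.2 (Nat.lt_succ_of_le (Finset.le_sup (f := id) hi))⟩
  -- Padding with `univ` turns the box into one over an initial segment, from which coordinate 0
  -- splits off.
  set t' : ℕ → Set G := fun i => if i ∈ s then t i else Set.univ with ht'
  have hm : ∀ i, MeasurableSet (t' i) := fun i => by
    by_cases h : i ∈ s <;> simp [ht', h, ht]
  have hpre : consSeq ⁻¹' (Set.pi s t) =
      t' 0 ×ˢ Set.pi (Finset.range N) (fun i => t' (i + 1)) := by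
    ext ⟨g, Y⟩
    simp only [Set.mem_preimage, Set.mem_pi, Set.mem_prod, Finset.mem_coe, Finset.mem_range, ht']
    constructor
    · intro h
      refine ⟨?_, fun i _ => ?_⟩
      · split_ifs with h0
        · exact h 0 h0
        · trivial
      · split_ifs with h0
        · exact h (i + 1) h0
        · trivial
    · rintro ⟨h0, h⟩ i hi
      cases i with
      | zero =>
        rw [if_pos hi] at h0
        exact h0
      | succ i =>
        have := h i (by simpa using hN hi)
        rw [if_pos hi] at this
        exact this
  rw [Measure.map_apply measurable_consSeq (.pi s.countable_toSet fun _ _ => ht _), hpre,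
    Measure.prod_prod, Measure.infinitePi_pi _ (fun i _ => hm _), mul_comm,
    ← Finset.prod_range_succ' (fun i => μ (t' i)) N,
    ← Finset.prod_subset hN (fun i _ hi => by simp [ht', hi])]
  exact Finset.prod_congr rfl fun i hi => by simp [ht', hi]

variable {G X : Type*} [Group G] [MulAction G X]

theorem walk_consSeq (x : X) (g : G) (Y : ℕ → G) (n : ℕ) :
    walk x (consSeq (g, Y)) (n + 1) = walk (g • x) Y n := by
  induction n with
  | zero => rfl
  | succ n ih =>
    change Y n • walk x (consSeq (g, Y)) (n + 1) = Y n • walk (g • x) Y n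
    rw [ih]

theorem setOf_not_frequently_eq {α X : Type*} (w : α → ℕ → X) (B : Set X) :
    {p : α | ¬ ∃ᶠ k in atTop, w p k ∈ B} = ⋃ n : ℕ, {p | ∀ k, n ≤ k → w p k ∉ B} := by
  ext p
  simp [not_frequently, eventually_atTop]

variable [MeasurableSpace G]

/-- Conditioning on the first increment, by Fubini and `map_consSeq`. It yields both the recursion
for `avoidProb` and the harmonicity of `escapeProb`. -/
theorem infinitePi_eq_lintegral_smul (μ : Measure G) [IsProbabilityMeasure μ]
    {E E' : X → Set (ℕ → G)} (hE' : ∀ x, MeasurableSet (E' x))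
    (h : ∀ x g Y, consSeq (g, Y) ∈ E' x ↔ Y ∈ E (g • x)) (x : X) :
    Measure.infinitePi (fun _ : ℕ => μ) (E' x) =
      ∫⁻ g, Measure.infinitePi (fun _ : ℕ => μ) (E (g • x)) ∂μ := by
  conv_lhs => rw [← map_consSeq μ]
  rw [Measure.map_apply measurable_consSeq (hE' x),
    Measure.prod_apply (measurable_consSeq (hE' x))]
  refine lintegral_congr fun g => ?_
  congr 1
  ext Y
  exact h x g Y

/-- The probability that the walk started at `x` stays outside `B` at all times `k ≥ n`. -/
noncomputable def avoidProb (μ : Measure G) [IsProbabilityMeasure μ] (B : Set X) (n : ℕ) (x : X) :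
    ℝ≥0∞ :=
  Measure.infinitePi (fun _ : ℕ => μ) {Y | ∀ k, n ≤ k → walk x Y k ∉ B}

/-- The probability that the walk started at `x` visits `B` only finitely often. -/
noncomputable def escapeProb (μ : Measure G) [IsProbabilityMeasure μ] (B : Set X) (x : X) :
    ℝ≥0∞ :=
  Measure.infinitePi (fun _ : ℕ => μ) {Y | ¬ ∃ᶠ k in atTop, walk x Y k ∈ B}

variable (μ : Measure G) [IsProbabilityMeasure μ] {B : Set X}

theorem avoidProb_le_one (n : ℕ) (x : X) : avoidProb μ B n x ≤ 1 := prob_le_one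

theorem escapeProb_le_one (x : X) : escapeProb μ B x ≤ 1 := prob_le_one

theorem avoidProb_zero_of_mem {x : X} (hx : x ∈ B) : avoidProb μ B 0 x = 0 := by
  have : {Y : ℕ → G | ∀ k, 0 ≤ k → walk x Y k ∉ B} = ∅ :=
    Set.eq_empty_of_forall_notMem fun Y h => h 0 le_rfl hx
  rw [avoidProb, this, measure_empty]

theorem avoidProb_mono (x : X) : Monotone fun n => avoidProb μ B n x :=
  fun _ _ h => measure_mono fun _ hY k hk => hY k (h.trans hk)

theorem escapeProb_le_tsum (x : X) : escapeProb μ B x ≤ ∑' n, avoidProb μ B n x := by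
  rw [escapeProb, setOf_not_frequently_eq (fun Y : ℕ → G => walk x Y)]
  exact measure_iUnion_le _

variable [MeasurableSpace X] [MeasurableSMul₂ G X]

theorem measurable_walk (n : ℕ) : Measurable fun p : X × (ℕ → G) => walk p.1 p.2 n := by
  induction n with
  | zero => exact measurable_fst
  | succ n ih => exact ((measurable_pi_apply n).comp measurable_snd).smul ih

theorem measurableSet_avoid (hB : MeasurableSet B) (n : ℕ) :
    MeasurableSet {p : X × (ℕ → G) | ∀ k, n ≤ k → walk p.1 p.2 k ∉ B} := by
  simp only [Set.ofPred_forall]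
  exact .iInter fun k => .iInter fun _ => measurable_walk k hB.compl

theorem measurableSet_escape (hB : MeasurableSet B) :
    MeasurableSet {p : X × (ℕ → G) | ¬ ∃ᶠ k in atTop, walk p.1 p.2 k ∈ B} := by
  rw [setOf_not_frequently_eq (fun p : X × (ℕ → G) => walk p.1 p.2)]
  exact .iUnion fun n => measurableSet_avoid hB n

theorem measurable_avoidProb (hB : MeasurableSet B) (n : ℕ) :
    Measurable (avoidProb μ B n) :=
  measurable_measure_prodMk_left (measurableSet_avoid hB n)

theorem measurable_escapeProb (hB : MeasurableSet B) : Measurable (escapeProb μ B) :=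
  measurable_measure_prodMk_left (measurableSet_escape hB)

theorem avoidProb_succ (hB : MeasurableSet B) (n : ℕ) (x : X) :
    avoidProb μ B (n + 1) x = ∫⁻ g, avoidProb μ B n (g • x) ∂μ := by
  refine infinitePi_eq_lintegral_smul μ
    (E := fun x => {Y | ∀ k, n ≤ k → walk x Y k ∉ B})
    (E' := fun x => {Y | ∀ k, n + 1 ≤ k → walk x Y k ∉ B})
    (fun x => measurable_prodMk_left (measurableSet_avoid hB (n + 1))) (fun x g Y => ?_) x
  constructor
  · intro h k hk
    rw [← walk_consSeq]
    exact h (k + 1) (by omega)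
  · intro h k hk
    obtain ⟨k, rfl⟩ : ∃ j, k = j + 1 := ⟨k - 1, by omega⟩
    rw [walk_consSeq]
    exact h k (by omega)

theorem escapeProb_eq_lintegral (hB : MeasurableSet B) (x : X) :
    escapeProb μ B x = ∫⁻ g, escapeProb μ B (g • x) ∂μ := by
  refine infinitePi_eq_lintegral_smul μ
    (E := fun x => {Y | ¬ ∃ᶠ k in atTop, walk x Y k ∈ B})
    (E' := fun x => {Y | ¬ ∃ᶠ k in atTop, walk x Y k ∈ B})
    (fun x => measurable_prodMk_left (measurableSet_escape hB)) (fun x g Y => ?_) x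
  simp only [Set.mem_ofPred_eq, not_iff_not, frequently_atTop]
  simp_rw [← walk_consSeq x g Y]
  constructor
  · intro h a
    obtain ⟨b, hb, hw⟩ := h (a + 1)
    obtain ⟨b, rfl⟩ : ∃ j, b = j + 1 := ⟨b - 1, by omega⟩
    exact ⟨b, by omega, hw⟩
  · intro h a
    obtain ⟨b, hb, hw⟩ := h a
    exact ⟨b + 1, by omega, hw⟩

end Shift

/-! ### Null sets of `X` versus Haar-null sets along orbit maps -/

section Orbits

variable {G X : Type*} [Group G] [TopologicalSpace G] [IsTopologicalGroup G]
  [LocallyCompactSpace G] [SecondCountableTopology G] [MeasurableSpace G] [BorelSpace G]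
  [MulAction G X]

/-- Moving the base point is a right translation in `G`, which preserves Haar-null sets even when
`G` is not unimodular. -/
theorem haar_preimage_smul_eq_zero_of_smul {N : Set X} {x : X} (a : G)
    (h : (Measure.haar : Measure G) {g : G | g • x ∈ N} = 0) :
    (Measure.haar : Measure G) {g : G | g • a • x ∈ N} = 0 := by
  rw [← measure_mul_right_null Measure.haar a] at h
  convert h using 2
  ext g
  simp [mul_smul]

variable [MeasurableSpace X] [MeasurableSMul₂ G X]
  {m : Measure X} [SigmaFinite m] [SMulInvariantMeasure G X m]

theorem lintegral_haar_preimage_smul {N : Set X} (hN : MeasurableSet N) :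
    ∫⁻ y, (Measure.haar : Measure G) {g : G | g • y ∈ N} ∂m =
      m N * (Measure.haar : Measure G) Set.univ := by
  have h : MeasurableSet {p : X × G | p.2 • p.1 ∈ N} :=
    (measurable_snd.smul measurable_fst) hN
  calc ∫⁻ y, (Measure.haar : Measure G) {g : G | g • y ∈ N} ∂m
      = (m.prod (Measure.haar : Measure G)) {p : X × G | p.2 • p.1 ∈ N} :=
        (Measure.prod_apply h).symm
    _ = ∫⁻ g, m ((g • ·) ⁻¹' N) ∂(Measure.haar : Measure G) := Measure.prod_apply_symm h
    _ = m N * (Measure.haar : Measure G) Set.univ := by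
        simp_rw [measure_preimage_smul]
        simp

/-- A set in a transitive `G`-space is null for the invariant measure if and only if its preimage
under some (equivalently, any) orbit map is Haar null. -/
theorem haar_preimage_smul_eq_zero_iff [MulAction.IsPretransitive G X] (hm : m ≠ 0) {N : Set X}
    (hN : MeasurableSet N) (x : X) :
    (Measure.haar : Measure G) {g : G | g • x ∈ N} = 0 ↔ m N = 0 := by
  have h := lintegral_haar_preimage_smul (G := G) (m := m) hN
  constructor
  · intro hx
    have h0 : ∀ y, (Measure.haar : Measure G) {g : G | g • y ∈ N} = 0 := fun y => by
      obtain ⟨a, rfl⟩ := MulAction.exists_smul_eq G x y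
      exact haar_preimage_smul_eq_zero_of_smul a hx
    simp only [h0, lintegral_zero] at h
    rcases mul_eq_zero.1 h.symm with h | h
    · exact h
    · exact absurd h (NeZero.ne _)
  · intro hN0
    have hmeas : Measurable fun y : X => (Measure.haar : Measure G) {g : G | g • y ∈ N} :=
      measurable_measure_prodMk_left ((measurable_snd.smul measurable_fst) hN)
    rw [hN0, zero_mul, lintegral_eq_zero_iff hmeas] at h
    have : (ae m).NeBot := ae_neBot.2 hm
    obtain ⟨y, hy⟩ := h.exists
    obtain ⟨a, rfl⟩ := MulAction.exists_smul_eq G y x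
    exact haar_preimage_smul_eq_zero_of_smul a hy

end Orbits

/-! ### Reversibility and the Hardy inequality -/

section Energy

variable {G X : Type*} [Group G] [MeasurableSpace G] [MeasurableInv G]
  [MulAction G X] [MeasurableSpace X] [MeasurableSMul₂ G X]
  {m : Measure X} [SigmaFinite m] [SMulInvariantMeasure G X m]
  {μ : Measure G} [IsProbabilityMeasure μ]

/-- Reversibility: `(x, g) ↦ (g • x, g⁻¹)` preserves `m × μ`. -/
theorem lintegral_prod_smul_inv (hsymm : IsSymmetric μ) {F : X × G → ℝ≥0∞} (hF : Measurable F) :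
    ∫⁻ p, F (p.2 • p.1, p.2⁻¹) ∂(m.prod μ) = ∫⁻ p, F p ∂(m.prod μ) := by
  have hinv : μ.map (fun g => g⁻¹) = μ := by
    ext s hs
    rw [Measure.map_apply measurable_inv hs]
    exact (hsymm s hs).symm
  rw [lintegral_prod_symm' _ (by fun_prop), lintegral_prod_symm' _ hF]
  have h1 : ∀ g : G, ∫⁻ x, F (g • x, g⁻¹) ∂m = ∫⁻ x, F (x, g⁻¹) ∂m := fun g =>
    (measurePreserving_smul g m).lintegral_comp (f := fun x => F (x, g⁻¹)) (by fun_prop)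
  simp_rw [h1]
  conv_rhs => rw [← hinv]
  rw [lintegral_map hF.lintegral_prod_left' measurable_inv]

/-- The Hardy-type inequality attached to a superharmonic function `f`. -/
theorem lintegral_superharmonic_le_energy (hsymm : IsSymmetric μ) {f : X → ℝ}
    (hf : Measurable f) (hf0 : ∀ x, 0 < f x)
    (hP : ∀ x, ∫⁻ g, ENNReal.ofReal (f (g • x)) ∂μ ≤ ENNReal.ofReal (f x))
    {u : X → ℝ} (hu : Measurable u) (hu0 : ∀ x, 0 ≤ u x)
    (hfin : ∫⁻ x, ENNReal.ofReal (u x ^ 2) ∂m ≠ ∞) :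
    ∫⁻ p, ENNReal.ofReal ((f p.1 * u (p.2 • p.1) - f (p.2 • p.1) * u p.1) ^ 2 /
        (f p.1 * f (p.2 • p.1))) ∂(m.prod μ) ≤
      ∫⁻ p, ENNReal.ofReal ((u (p.2 • p.1) - u p.1) ^ 2) ∂(m.prod μ) := by
  set J := ∫⁻ x, ENNReal.ofReal (u x ^ 2) ∂m with hJ
  have hJ1 : ∫⁻ p : X × G, ENNReal.ofReal (u p.1 ^ 2) ∂(m.prod μ) = J := by
    rw [lintegral_prod _ (by fun_prop)]
    simp [hJ]
  have hJ2 : ∫⁻ p : X × G, ENNReal.ofReal (u (p.2 • p.1) ^ 2) ∂(m.prod μ) = J := by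
    rw [← hJ1]
    exact lintegral_prod_smul_inv (m := m) hsymm
      (F := fun p => ENNReal.ofReal (u p.1 ^ 2)) (by fun_prop)
  -- The only use of superharmonicity: integrate in `g` first. The mirror bound `hA'` follows by
  -- reversibility.
  have hA : ∫⁻ p : X × G, ENNReal.ofReal (f (p.2 • p.1) / f p.1 * u p.1 ^ 2) ∂(m.prod μ) ≤ J := by
    rw [lintegral_prod _ (by fun_prop)]
    refine lintegral_mono fun x => ?_
    have h1 : ∀ g : G, ENNReal.ofReal (f (g • x) / f x * u x ^ 2) =
        ENNReal.ofReal (u x ^ 2 / f x) * ENNReal.ofReal (f (g • x)) := fun g => by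
      rw [← ENNReal.ofReal_mul (div_nonneg (sq_nonneg _) (hf0 x).le)]
      congr 1
      ring
    simp only [h1]
    rw [lintegral_const_mul _ (by fun_prop)]
    calc _ ≤ ENNReal.ofReal (u x ^ 2 / f x) * ENNReal.ofReal (f x) := by gcongr; exact hP x
      _ = ENNReal.ofReal (u x ^ 2) := by
        rw [← ENNReal.ofReal_mul (div_nonneg (sq_nonneg _) (hf0 x).le),
          div_mul_cancel₀ _ (hf0 x).ne']
  have hA' : ∫⁻ p : X × G, ENNReal.ofReal (f p.1 / f (p.2 • p.1) * u (p.2 • p.1) ^ 2)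
      ∂(m.prod μ) ≤ J := by
    rw [← lintegral_prod_smul_inv (m := m) hsymm (by fun_prop)] at hA
    simpa using hA
  -- Expanding both squares produces the same cross term `D`. It is added to both sides, where the
  -- bounds become `J + J`, and cancelled at the end because it is finite.
  set D := ∫⁻ p : X × G, ENNReal.ofReal (2 * u p.1 * u (p.2 • p.1)) ∂(m.prod μ) with hD
  have hu2 : ∀ p : X × G, 0 ≤ 2 * u p.1 * u (p.2 • p.1) := fun p =>
    mul_nonneg (mul_nonneg zero_le_two (hu0 _)) (hu0 _)
  have hR : ∫⁻ p, ENNReal.ofReal ((u (p.2 • p.1) - u p.1) ^ 2) ∂(m.prod μ) + D = J + J := by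
    conv_rhs => rw [← hJ2]
    conv_rhs => arg 2; rw [hJ2, ← hJ1]
    rw [hD, ← lintegral_add_left (by fun_prop), ← lintegral_add_left (by fun_prop)]
    refine lintegral_congr fun p => ?_
    rw [← ENNReal.ofReal_add (sq_nonneg _) (hu2 p), ← ENNReal.ofReal_add (sq_nonneg _) (sq_nonneg _)]
    congr 1
    ring
  have hL : ∫⁻ p, ENNReal.ofReal ((f p.1 * u (p.2 • p.1) - f (p.2 • p.1) * u p.1) ^ 2 /
        (f p.1 * f (p.2 • p.1))) ∂(m.prod μ) + D ≤ J + J := by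
    refine le_trans (le_of_eq ?_) (add_le_add hA' hA)
    rw [hD, ← lintegral_add_left (by fun_prop), ← lintegral_add_left (by fun_prop)]
    refine lintegral_congr fun p => ?_
    have h1 := hf0 p.1
    have h2 := hf0 (p.2 • p.1)
    rw [← ENNReal.ofReal_add (by positivity) (hu2 p),
      ← ENNReal.ofReal_add (by positivity) (by positivity)]
    congr 1
    field_simp
    ring
  have hDfin : D ≠ ∞ := by
    refine ne_top_of_le_ne_top (ENNReal.add_ne_top.2 ⟨hfin, hfin⟩) ?_
    rw [← hR]
    exact le_add_self
  rw [← hR] at hL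
  exact (ENNReal.add_le_add_iff_right hDfin).1 hL

/-- If there are cutoff functions of vanishing energy, then superharmonic functions are invariant
along almost every step of the walk. -/
theorem ae_smul_eq_of_superharmonic (hsymm : IsSymmetric μ) {f : X → ℝ}
    (hf : Measurable f) (hf0 : ∀ x, 0 < f x)
    (hP : ∀ x, ∫⁻ g, ENNReal.ofReal (f (g • x)) ∂μ ≤ ENNReal.ofReal (f x))
    {u : ℕ → X → ℝ} (hu : ∀ n, Measurable (u n)) (hu0 : ∀ n x, 0 ≤ u n x)
    (hfin : ∀ n, ∫⁻ x, ENNReal.ofReal (u n x ^ 2) ∂m ≠ ∞)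
    (hlim : ∀ x, Tendsto (fun n => u n x) atTop (𝓝 1))
    (henergy : Tendsto (fun n => ∫⁻ p, ENNReal.ofReal ((u n (p.2 • p.1) - u n p.1) ^ 2) ∂(m.prod μ))
      atTop (𝓝 0)) :
    ∀ᵐ p ∂(m.prod μ), f (p.2 • p.1) = f p.1 := by
  set L : ℕ → X × G → ℝ≥0∞ := fun n p =>
    ENNReal.ofReal ((f p.1 * u n (p.2 • p.1) - f (p.2 • p.1) * u n p.1) ^ 2 /
        (f p.1 * f (p.2 • p.1))) with hL
  have hLm : ∀ n, Measurable (L n) := fun n => by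
    have := hu n
    fun_prop
  have hLlim : ∀ p : X × G, Tendsto (fun n => L n p) atTop (𝓝 (ENNReal.ofReal
      ((f p.1 - f (p.2 • p.1)) ^ 2 / (f p.1 * f (p.2 • p.1))))) := fun p => by
    refine ENNReal.tendsto_ofReal ?_
    have := ((((hlim (p.2 • p.1)).const_mul (f p.1)).sub
      ((hlim p.1).const_mul (f (p.2 • p.1)))).pow 2).div_const (f p.1 * f (p.2 • p.1))
    simpa using this
  have hint : Tendsto (fun n => ∫⁻ p, L n p ∂(m.prod μ)) atTop (𝓝 0) :=
    tendsto_of_tendsto_of_tendsto_of_le_of_le tendsto_const_nhds henergy (fun _ => zero_le)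
      fun n => lintegral_superharmonic_le_energy hsymm hf hf0 hP (hu n) (hu0 n) (hfin n)
  have h0 : ∫⁻ p, ENNReal.ofReal ((f p.1 - f (p.2 • p.1)) ^ 2 / (f p.1 * f (p.2 • p.1)))
      ∂(m.prod μ) = 0 := by
    refine le_antisymm ?_ zero_le
    -- Fatou's lemma: the integrands `L n` converge pointwise and their integrals tend to 0.
    rw [← hint.liminf_eq]
    refine le_trans (le_of_eq ?_) (lintegral_liminf_le hLm)
    exact lintegral_congr fun p => (hLlim p).liminf_eq.symm
  rw [lintegral_eq_zero_iff (by fun_prop)] at h0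
  filter_upwards [h0] with p hp
  have h1 := hf0 p.1
  have h2 := hf0 (p.2 • p.1)
  have h3 := ENNReal.ofReal_eq_zero.1 hp
  rw [div_le_iff₀ (by positivity), zero_mul] at h3
  have := pow_eq_zero_iff (two_ne_zero) |>.1 (le_antisymm h3 (sq_nonneg _))
  linarith

end Energy

/-! ### Logarithmic cutoffs on the integers -/

section Cutoff

/-- The harmonic numbers as real numbers. -/
noncomputable def harmonicSum (n : ℕ) : ℝ := ∑ i ∈ Finset.range n, 1 / ((i : ℝ) + 1)

theorem harmonicSum_succ (n : ℕ) : harmonicSum (n + 1) = harmonicSum n + 1 / ((n : ℝ) + 1) :=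
  Finset.sum_range_succ _ _

theorem harmonicSum_mono : Monotone harmonicSum :=
  monotone_nat_of_le_succ fun n => by
    rw [harmonicSum_succ]
    have : 0 ≤ 1 / ((n : ℝ) + 1) := by positivity
    linarith

theorem harmonicSum_nonneg (n : ℕ) : 0 ≤ harmonicSum n := by
  simpa [harmonicSum] using harmonicSum_mono (Nat.zero_le n)

theorem harmonicSum_succ_pos (n : ℕ) : 0 < harmonicSum (n + 1) := by
  have := harmonicSum_nonneg n
  rw [harmonicSum_succ]
  positivity

theorem tendsto_harmonicSum : Tendsto harmonicSum atTop atTop :=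
  Real.tendsto_sum_range_one_div_nat_succ_atTop

/-- The logarithmic cutoff function of radius `N + 1`. -/
noncomputable def logCutoff (N t : ℕ) : ℝ := max 0 (1 - harmonicSum t / harmonicSum (N + 1))

theorem logCutoff_nonneg (N t : ℕ) : 0 ≤ logCutoff N t := le_max_left _ _

theorem logCutoff_le_one (N t : ℕ) : logCutoff N t ≤ 1 :=
  max_le zero_le_one (sub_le_self _ (div_nonneg (harmonicSum_nonneg _) (harmonicSum_nonneg _)))

theorem logCutoff_eq_zero {N t : ℕ} (h : N + 1 ≤ t) : logCutoff N t = 0 := by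
  refine max_eq_left (sub_nonpos.2 ?_)
  rw [le_div_iff₀ (harmonicSum_succ_pos N), one_mul]
  exact harmonicSum_mono h

theorem tendsto_logCutoff (t : ℕ) : Tendsto (fun N => logCutoff N t) atTop (𝓝 1) := by
  have h : Tendsto (fun N => harmonicSum t / harmonicSum (N + 1)) atTop (𝓝 0) :=
    (tendsto_harmonicSum.comp (tendsto_add_atTop_nat 1)).const_div_atTop _
  have := (tendsto_const_nhds (x := (0 : ℝ))).max ((tendsto_const_nhds (x := (1 : ℝ))).sub h)
  simpa [logCutoff] using this

/-- The harmonic sum moves by at most `1 / max a 1` in a unit step, and truncation at 0 is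
1-Lipschitz. Beyond `N + 1` both values vanish, since then `b ≥ N + 1` as well. -/
theorem logCutoff_sub_sq_le (N : ℕ) {a b : ℕ} (hab : a ≤ b + 1) (hba : b ≤ a + 1) :
    (logCutoff N b - logCutoff N a) ^ 2 ≤
      (harmonicSum (N + 1) ^ 2)⁻¹ * if a ≤ N + 1 then ((max a 1 : ℕ) ^ 2 : ℝ)⁻¹ else 0 := by
  have hpos := harmonicSum_succ_pos N
  split_ifs with h
  · have hH : |harmonicSum b - harmonicSum a| ≤ ((max a 1 : ℕ) : ℝ)⁻¹ := by
      have hm : (0 : ℝ) < (max a 1 : ℕ) := by exact_mod_cast lt_max_of_lt_right one_pos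
      obtain rfl | rfl | rfl : b = a + 1 ∨ b = a ∨ a = b + 1 := by omega
      · rw [harmonicSum_succ, add_sub_cancel_left, abs_of_nonneg (by positivity), one_div]
        refine inv_anti₀ hm ?_
        exact_mod_cast max_le (by omega) (by omega)
      · simp
      · rw [harmonicSum_succ, sub_add_cancel_left, abs_neg, abs_of_nonneg (by positivity), one_div]
        refine inv_anti₀ hm ?_
        exact_mod_cast max_le (by omega) (by omega)
    rw [← inv_pow, ← inv_pow, ← mul_pow, ← sq_abs]
    refine pow_le_pow_left₀ (abs_nonneg _) ?_ 2
    refine (abs_max_sub_max_le_max _ _ _ _).trans ?_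
    rw [sub_self, abs_zero, max_eq_right (abs_nonneg _), sub_sub_sub_cancel_left, ← sub_div,
      abs_div, abs_of_pos hpos, abs_sub_comm, div_eq_inv_mul]
    gcongr
  · rw [logCutoff_eq_zero (by omega), logCutoff_eq_zero (by omega)]
    simp

/-- A discrete layer-cake bound for the inverse square. -/
theorem inv_sq_le_sum (N t : ℕ) :
    (if t ≤ N + 1 then ((max t 1 : ℕ) ^ 2 : ℝ)⁻¹ else 0) ≤
      (if t ≤ N + 1 then (((N : ℝ) + 1) ^ 2)⁻¹ else 0) +
        ∑ i ∈ Finset.range N, if t ≤ i + 1 then 3 * (((i : ℝ) + 1) ^ 3)⁻¹ else 0 := by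
  induction N with
  | zero =>
    simp only [zero_add, Finset.range_zero, Finset.sum_empty, add_zero]
    split_ifs with h
    · rw [max_eq_right h]
      simp
    · exact le_rfl
  | succ N ih =>
    rw [Finset.sum_range_succ]
    have hs : 0 ≤ ∑ i ∈ Finset.range N, if t ≤ i + 1 then 3 * (((i : ℝ) + 1) ^ 3)⁻¹ else 0 :=
      Finset.sum_nonneg fun i _ => by split_ifs <;> positivity
    by_cases h : t ≤ N + 1
    · simp only [h, if_true, h.trans (Nat.le_succ (N + 1))] at ih ⊢
      -- Summation by parts: the drop of the inverse square from `N + 1` to `N + 2` is of order `(N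
      -- + 1)⁻³`; the factor 3 is a convenient bound.
      have key : (((N : ℝ) + 1) ^ 2)⁻¹ ≤ ((((N + 1 : ℕ) : ℝ) + 1) ^ 2)⁻¹ + 3 * (((N : ℝ) + 1) ^ 3)⁻¹ := by
        push_cast
        have hN : (0 : ℝ) ≤ N := N.cast_nonneg
        rw [← sub_nonneg]
        have : (((N : ℝ) + 1 + 1) ^ 2)⁻¹ + 3 * (((N : ℝ) + 1) ^ 3)⁻¹ - (((N : ℝ) + 1) ^ 2)⁻¹ =
            (((N : ℝ) + 1) ^ 3 + 3 * ((N : ℝ) + 1 + 1) ^ 2 - ((N : ℝ) + 1) * ((N : ℝ) + 1 + 1) ^ 2) /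
              (((N : ℝ) + 1 + 1) ^ 2 * ((N : ℝ) + 1) ^ 3) := by
          field_simp
        rw [this]
        refine div_nonneg ?_ (by positivity)
        nlinarith
      linarith
    · by_cases h' : t = N + 1 + 1
      · subst h'
        rw [if_pos (le_refl (N + 1 + 1)), if_pos (le_refl (N + 1 + 1)), if_neg h, add_zero,
          max_eq_left (by omega)]
        have hc : ((N + 1 : ℕ) : ℝ) + 1 = ((N + 1 + 1 : ℕ) : ℝ) := by push_cast; rfl
        rw [hc]
        exact le_add_of_nonneg_right hs
      · have h2 : ¬ t ≤ N + 1 + 1 := by omega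
        simp only [h, h2, if_false]
        linarith

end Cutoff

/-! ### Energy of the cutoffs under quadratic growth -/

section LogarithmicEnergy

variable {X : Type*} [MeasurableSpace X] {m : Measure X} {d : X → ℕ} {C : ℝ}

/-- In the layer-cake sum a ball of volume `C (i + 1) ^ 2` has weight `3 (i + 1)⁻³`, so its
contribution is `3 C / (i + 1)`. This is where degree two gives logarithmic growth. -/
theorem lintegral_inv_sq_le (hd : Measurable d) (hC : 0 ≤ C)
    (hball : ∀ n : ℕ, m {x | d x ≤ n + 1} ≤ ENNReal.ofReal (C * ((n : ℝ) + 1) ^ 2)) (N : ℕ) :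
    ∫⁻ x, ENNReal.ofReal (if d x ≤ N + 1 then ((max (d x) 1 : ℕ) ^ 2 : ℝ)⁻¹ else 0) ∂m ≤
      ENNReal.ofReal (C + 3 * C * harmonicSum N) := by
  have hmeas : ∀ n : ℕ, MeasurableSet {x | d x ≤ n} := fun n => hd (measurableSet_Iic (a := n))
  have hint : ∀ (n : ℕ) (c : ℝ), 0 ≤ c →
      ∫⁻ x, ENNReal.ofReal (if d x ≤ n + 1 then c else 0) ∂m ≤
        ENNReal.ofReal (c * (C * ((n : ℝ) + 1) ^ 2)) := fun n c hc => by
    have : ∀ x, ENNReal.ofReal (if d x ≤ n + 1 then c else 0) =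
        {x | d x ≤ n + 1}.indicator (fun _ => ENNReal.ofReal c) x := fun x => by
      by_cases h : d x ≤ n + 1 <;> simp [h]
    simp only [this]
    rw [lintegral_indicator_const (hmeas _), ENNReal.ofReal_mul hc]
    gcongr
    exact hball n
  have hm1 : ∀ (n : ℕ) (c : ℝ), Measurable fun x => if d x ≤ n then c else 0 := fun n c =>
    Measurable.ite (hmeas n) measurable_const measurable_const
  calc ∫⁻ x, ENNReal.ofReal (if d x ≤ N + 1 then ((max (d x) 1 : ℕ) ^ 2 : ℝ)⁻¹ else 0) ∂m
      ≤ ∫⁻ x, (ENNReal.ofReal (if d x ≤ N + 1 then (((N : ℝ) + 1) ^ 2)⁻¹ else 0) +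
          ∑ i ∈ Finset.range N,
            ENNReal.ofReal (if d x ≤ i + 1 then 3 * (((i : ℝ) + 1) ^ 3)⁻¹ else 0)) ∂m := by
        refine lintegral_mono fun x => ?_
        rw [← ENNReal.ofReal_sum_of_nonneg (fun i _ => by split_ifs <;> positivity),
          ← ENNReal.ofReal_add (by split_ifs <;> positivity)
            (Finset.sum_nonneg fun i _ => by split_ifs <;> positivity)]
        exact ENNReal.ofReal_le_ofReal (inv_sq_le_sum N (d x))
    _ = ∫⁻ x, ENNReal.ofReal (if d x ≤ N + 1 then (((N : ℝ) + 1) ^ 2)⁻¹ else 0) ∂m +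
          ∑ i ∈ Finset.range N,
            ∫⁻ x, ENNReal.ofReal (if d x ≤ i + 1 then 3 * (((i : ℝ) + 1) ^ 3)⁻¹ else 0) ∂m := by
        rw [lintegral_add_left (hm1 _ _).ennreal_ofReal,
          lintegral_finsetSum _ fun i _ => (hm1 _ _).ennreal_ofReal]
    _ ≤ ENNReal.ofReal ((((N : ℝ) + 1) ^ 2)⁻¹ * (C * ((N : ℝ) + 1) ^ 2)) +
          ∑ i ∈ Finset.range N,
            ENNReal.ofReal (3 * (((i : ℝ) + 1) ^ 3)⁻¹ * (C * ((i : ℝ) + 1) ^ 2)) := by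
        gcongr with i
        · exact hint N _ (by positivity)
        · exact hint i _ (by positivity)
    _ = ENNReal.ofReal (C + 3 * C * harmonicSum N) := by
        rw [← ENNReal.ofReal_sum_of_nonneg (fun i _ => by positivity),
          ← ENNReal.ofReal_add (by positivity) (Finset.sum_nonneg fun i _ => by positivity)]
        congr 2
        · field_simp
        · rw [harmonicSum, Finset.mul_sum]
          refine Finset.sum_congr rfl fun i _ => ?_
          have : (i : ℝ) + 1 ≠ 0 := by positivity
          field_simp

theorem lintegral_logCutoff_sq_ne_top (hd : Measurable d)
    (hball : ∀ n : ℕ, m {x | d x ≤ n + 1} ≤ ENNReal.ofReal (C * ((n : ℝ) + 1) ^ 2)) (N : ℕ) :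
    ∫⁻ x, ENNReal.ofReal (logCutoff N (d x) ^ 2) ∂m ≠ ∞ := by
  have hmeas : MeasurableSet {x | d x ≤ N + 1} := hd (measurableSet_Iic (a := N + 1))
  refine ne_top_of_le_ne_top (ne_top_of_le_ne_top ENNReal.ofReal_ne_top (hball N)) ?_
  rw [← lintegral_indicator_one hmeas]
  refine lintegral_mono fun x => ?_
  by_cases h : d x ≤ N + 1
  · rw [Set.indicator_of_mem (by exact h), Pi.one_apply, ← ENNReal.ofReal_one]
    exact ENNReal.ofReal_le_ofReal (pow_le_one₀ (logCutoff_nonneg _ _) (logCutoff_le_one _ _))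
  · rw [logCutoff_eq_zero (by omega)]
    simp

/-- The integral of the inverse square grows like one harmonic sum, while the squared cutoff
gradient carries two in the denominator. -/
theorem tendsto_energy_logCutoff {G : Type*} [MeasurableSpace G] [SMul G X]
    {μ : Measure G} [IsProbabilityMeasure μ]
    (hd : Measurable d) (hC : 0 ≤ C)
    (hball : ∀ n : ℕ, m {x | d x ≤ n + 1} ≤ ENNReal.ofReal (C * ((n : ℝ) + 1) ^ 2))
    (hstep : ∀ᵐ g ∂μ, ∀ x, d x ≤ d (g • x) + 1 ∧ d (g • x) ≤ d x + 1) :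
    Tendsto (fun N => ∫⁻ p, ENNReal.ofReal
      ((logCutoff N (d (p.2 • p.1)) - logCutoff N (d p.1)) ^ 2) ∂(m.prod μ)) atTop (𝓝 0) := by
  have hH : Tendsto (fun N => (harmonicSum (N + 1))⁻¹) atTop (𝓝 0) :=
    (tendsto_harmonicSum.comp (tendsto_add_atTop_nat 1)).inv_tendsto_atTop
  have hbound : Tendsto (fun N => ENNReal.ofReal (C * (harmonicSum (N + 1))⁻¹ ^ 2 +
      3 * C * (harmonicSum (N + 1))⁻¹)) atTop (𝓝 0) := by
    have := ENNReal.tendsto_ofReal (((hH.pow 2).const_mul C).add (hH.const_mul (3 * C)))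
    simpa using this
  refine tendsto_of_tendsto_of_tendsto_of_le_of_le tendsto_const_nhds hbound
    (fun _ => zero_le) fun N => ?_
  have hpos := harmonicSum_succ_pos N
  set F : X → ℝ := fun x => if d x ≤ N + 1 then ((max (d x) 1 : ℕ) ^ 2 : ℝ)⁻¹ else 0 with hF
  have hFm : Measurable F :=
    (measurable_from_top (f := fun t : ℕ =>
      if t ≤ N + 1 then ((max t 1 : ℕ) ^ 2 : ℝ)⁻¹ else 0)).comp hd
  calc ∫⁻ p, ENNReal.ofReal
        ((logCutoff N (d (p.2 • p.1)) - logCutoff N (d p.1)) ^ 2) ∂(m.prod μ)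
      ≤ ∫⁻ p : X × G, ENNReal.ofReal (harmonicSum (N + 1) ^ 2)⁻¹ * ENNReal.ofReal (F p.1)
          ∂(m.prod μ) := by
        refine lintegral_mono_ae ?_
        filter_upwards [Measure.quasiMeasurePreserving_snd.ae hstep] with p hp
        rw [← ENNReal.ofReal_mul (by positivity)]
        exact ENNReal.ofReal_le_ofReal (logCutoff_sub_sq_le N (hp p.1).1 (hp p.1).2)
    _ = ENNReal.ofReal (harmonicSum (N + 1) ^ 2)⁻¹ * ∫⁻ x, ENNReal.ofReal (F x) ∂m := by
        rw [lintegral_const_mul _ (by fun_prop), lintegral_prod _ (by fun_prop)]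
        simp
    _ ≤ ENNReal.ofReal (harmonicSum (N + 1) ^ 2)⁻¹ *
          ENNReal.ofReal (C + 3 * C * harmonicSum (N + 1)) := by
        gcongr
        refine (lintegral_inv_sq_le hd hC hball N).trans (ENNReal.ofReal_le_ofReal ?_)
        gcongr
        exact harmonicSum_mono (Nat.le_succ N)
    _ = _ := by
        rw [← ENNReal.ofReal_mul (by positivity)]
        congr 1
        field_simp

end LogarithmicEnergy

/-! ### Word distance adapted to the support of `μ` -/

section Distance

variable {G X : Type*} [Group G] [TopologicalSpace G] [IsTopologicalGroup G]

theorem pow_subset_interior_pow_succ {V : Set G} (hV : V ∈ 𝓝 (1 : G)) (n : ℕ) :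
    V ^ n ⊆ interior (V ^ (n + 1)) := by
  intro g hg
  rw [mem_interior_iff_mem_nhds, pow_succ]
  have h1 : g • V ∈ 𝓝 g := by
    simpa using smul_mem_nhds_smul g hV
  refine mem_of_superset h1 ?_
  rintro _ ⟨v, hv, rfl⟩
  exact Set.mul_mem_mul hg hv

theorem exists_mem_pow_of_mem_closure {M : Type*} [Monoid M] {V : Set M} {g : M}
    (hg : g ∈ Submonoid.closure V) : ∃ n : ℕ, g ∈ V ^ n := by
  induction hg using Submonoid.closure_induction with
  | mem x hx => exact ⟨1, by simpa using hx⟩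
  | one => exact ⟨0, by simp⟩
  | mul x y _ _ hx hy =>
    obtain ⟨a, ha⟩ := hx
    obtain ⟨b, hb⟩ := hy
    exact ⟨a + b, by rw [pow_add]; exact Set.mul_mem_mul ha hb⟩

theorem exists_isCompact_subset_interior_pow {V : Set G} (hV : V ∈ 𝓝 (1 : G))
    (hgen : Submonoid.closure V = ⊤) {K : Set G} (hK : IsCompact K) :
    ∃ r : ℕ, K ⊆ interior (V ^ r) := by
  have h1 : (1 : G) ∈ V := mem_of_mem_nhds hV
  refine (hK.elim_directed_cover (fun r : ℕ => interior (V ^ r)) (fun _ => isOpen_interior)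
    (fun g _ => ?_) ?_)
  · obtain ⟨n, hn⟩ := exists_mem_pow_of_mem_closure (V := V) (g := g) (hgen ▸ Submonoid.mem_top g)
    exact Set.mem_iUnion.2 ⟨n + 1, pow_subset_interior_pow_succ hV n hn⟩
  · exact (Monotone.directed_le fun a b hab =>
      interior_mono (Set.pow_subset_pow_right h1 hab))

/-- The word distance from the base point `x₀` in a homogeneous space. -/
theorem exists_wordDistance [MulAction G X] [TopologicalSpace X] [MeasurableSpace X] [OpensMeasurableSpace X]
    [MulAction.IsPretransitive G X] (hopen : ∀ x : X, IsOpenMap fun g : G => g • x)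
    {m : Measure X} (hgrowth : HasPolynomialGrowth G m 2) {K : Set G} (hK : IsCompact K) :
    ∃ (d : X → ℕ) (C : ℝ), Measurable d ∧ 0 ≤ C ∧
      (∀ n : ℕ, m {x | d x ≤ n + 1} ≤ ENNReal.ofReal (C * ((n : ℝ) + 1) ^ 2)) ∧
      ∀ g ∈ K, ∀ x, d x ≤ d (g • x) + 1 ∧ d (g • x) ≤ d x + 1 := by
  obtain ⟨V, hV, -, hgen, x₀, hlim⟩ := hgrowth
  have h1 : (1 : G) ∈ V := mem_of_mem_nhds hV
  obtain ⟨r, hr⟩ := exists_isCompact_subset_interior_pow hV hgen (hK.union hK.inv)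
  -- An open set containing `V`, `K` and `K⁻¹`. Distances use `W ^ (n + 1)`, not `W ^ n`, so that
  -- every ball is the image of an open set and `d` is measurable.
  set W : Set G := interior (V ^ (r + 2)) with hW
  have hVW : V ⊆ W := by
    refine (Set.Subset.trans ?_ (pow_subset_interior_pow_succ hV (r + 1)))
    conv_lhs => rw [← pow_one V]
    exact Set.pow_subset_pow_right h1 (by omega)
  have h1W : (1 : G) ∈ W := hVW h1
  have hKW : K ∪ K⁻¹ ⊆ W :=
    hr.trans (interior_mono (Set.pow_subset_pow_right h1 (by omega)))
  have hex : ∀ x : X, ∃ n : ℕ, x ∈ (fun g : G => g • x₀) '' (W ^ (n + 1)) := fun x => by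
    obtain ⟨g, rfl⟩ := MulAction.exists_smul_eq G x₀ x
    obtain ⟨n, hn⟩ := exists_mem_pow_of_mem_closure (V := V) (g := g) (hgen ▸ Submonoid.mem_top g)
    exact ⟨n, g, Set.pow_subset_pow_right h1W (Nat.le_succ n) (Set.pow_subset_pow_left hVW hn), rfl⟩
  classical
  set d : X → ℕ := fun x => Nat.find (hex x) with hd
  have hle : ∀ x n, d x ≤ n ↔ x ∈ (fun g : G => g • x₀) '' (W ^ (n + 1)) := fun x n => by
    refine ⟨fun h => ?_, fun h => Nat.find_min' _ h⟩
    exact Set.image_mono (Set.pow_subset_pow_right h1W (Nat.succ_le_succ h))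
      (Nat.find_spec (hex x))
  have hstep : ∀ g ∈ W, ∀ x, d (g • x) ≤ d x + 1 := fun g hg x => by
    obtain ⟨a, ha, hax⟩ := (hle x _).1 le_rfl
    refine (hle _ _).2 ⟨g * a, ?_, ?_⟩
    · rw [pow_succ']
      exact Set.mul_mem_mul hg ha
    · change (g * a) • x₀ = g • x
      rw [← hax, mul_smul]
  have hmeas : Measurable d := by
    refine measurable_of_Iic fun n => ?_
    have : d ⁻¹' Set.Iic n = (fun g : G => g • x₀) '' (W ^ (n + 1)) := Set.ext fun x => hle x n
    rw [this, pow_succ]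
    exact ((hopen x₀) _ isOpen_interior.mul_left).measurableSet
  obtain ⟨c, hc, hc'⟩ := exists_between hlim
  obtain ⟨n₀, hn₀⟩ := eventually_atTop.1 (eventually_lt_of_limsup_lt hc)
  refine ⟨d, c.toReal * (2 * (r + 2) * (n₀ + 1)) ^ 2, hmeas, by positivity, fun n => ?_,
    fun g hg x => ⟨?_, hstep g (hKW (.inl hg)) x⟩⟩
  -- The ball `d ≤ n + 1` lies in `V ^ ((r + 2) * (n + 2)) x₀`. This `k` dominates that exponent and
  -- `n₀`, yet stays linear in `n + 1`.
  · set k : ℕ := 2 * (r + 2) * (n₀ + 1) * (n + 1) with hk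
    have hkn : n₀ ≤ k := by
      calc n₀ ≤ n₀ + 1 := n₀.le_succ
        _ ≤ (n₀ + 1) * (2 * (r + 2) * (n + 1)) := Nat.le_mul_of_pos_right _ (by positivity)
        _ = k := by rw [hk]; ring
    have hkr : (r + 2) * (n + 1 + 1) ≤ k := by
      have h2 : n + 1 + 1 ≤ 2 * (n + 1) := by omega
      calc (r + 2) * (n + 1 + 1) ≤ (r + 2) * (2 * (n + 1)) := Nat.mul_le_mul_left _ h2
        _ ≤ (r + 2) * (2 * (n + 1)) * (n₀ + 1) := Nat.le_mul_of_pos_right _ n₀.succ_pos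
        _ = k := by rw [hk]; ring
    have hk0 : 0 < k := by positivity
    have hsub : {x | d x ≤ n + 1} ⊆ (fun g : G => g • x₀) '' (V ^ k) := fun x hx => by
      refine Set.image_mono ?_ ((hle x _).1 hx)
      refine (Set.pow_subset_pow_left interior_subset).trans ?_
      rw [← pow_mul]
      exact Set.pow_subset_pow_right h1 hkr
    have hkt : ((k : ℝ≥0∞) ^ 2) ≠ ∞ := by simp
    have hkz : ((k : ℝ≥0∞) ^ 2) ≠ 0 := by simp [hk0.ne']
    calc m {x | d x ≤ n + 1} ≤ m ((fun g : G => g • x₀) '' (V ^ k)) := measure_mono hsub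
      _ ≤ c * (k : ℝ≥0∞) ^ 2 := ((ENNReal.div_lt_iff (.inl hkz) (.inl hkt)).1 (hn₀ k hkn)).le
      _ = ENNReal.ofReal (c.toReal * (k : ℝ) ^ 2) := by
        rw [ENNReal.ofReal_mul ENNReal.toReal_nonneg, ENNReal.ofReal_toReal hc'.ne,
          ENNReal.ofReal_pow k.cast_nonneg, ENNReal.ofReal_natCast]
      _ = _ := by
        congr 1
        rw [hk]
        push_cast
        ring
  · have := hstep g⁻¹ (hKW (.inr (by simpa using hg))) (g • x)
    rwa [inv_smul_smul] at this

end Distance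

/-! ### Convolution powers of `μ` -/

section ConvolutionPowers

variable {G X : Type*} [Group G] [MeasurableSpace G] [MeasurableMul₂ G]
  {μ : Measure G} [IsProbabilityMeasure μ]

instance isProbabilityMeasure_convPow (n : ℕ) : IsProbabilityMeasure (convPow μ n) := by
  induction n with
  | zero => exact inferInstanceAs (IsProbabilityMeasure (Measure.dirac 1))
  | succ n ih => exact inferInstanceAs (IsProbabilityMeasure (Measure.mconv μ (convPow μ n)))

omit [IsProbabilityMeasure μ] in
theorem ae_mem_convPow {S : Subgroup G} (hS : MeasurableSet (S : Set G)) (h : ∀ᵐ g ∂μ, g ∈ S)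
    (n : ℕ) : ∀ᵐ g ∂(convPow μ n), g ∈ S := by
  induction n with
  | zero =>
    change ∀ᵐ g ∂(Measure.dirac 1), g ∈ S
    rw [ae_dirac_iff (p := fun g => g ∈ S) hS]
    exact S.one_mem
  | succ n ih =>
    change ∀ᵐ g ∂(Measure.map (fun p : G × G => p.1 * p.2) (μ.prod (convPow μ n))), g ∈ S
    rw [ae_map_iff (p := fun g => g ∈ S) measurable_mul.aemeasurable hS]
    filter_upwards [Measure.quasiMeasurePreserving_fst.ae h,
      Measure.quasiMeasurePreserving_snd.ae ih] with p h1 h2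
    exact S.mul_mem h1 h2

theorem lintegral_convPow_of_harmonic [MulAction G X] [MeasurableSpace X] [MeasurableSMul₂ G X]
    {k : X → ℝ≥0∞} (hk : Measurable k) (hharm : ∀ x, k x = ∫⁻ g, k (g • x) ∂μ) (n : ℕ) (x : X) :
    k x = ∫⁻ g, k (g • x) ∂(convPow μ n) := by
  induction n with
  | zero =>
    change k x = ∫⁻ g, k (g • x) ∂(Measure.dirac 1)
    rw [lintegral_dirac' _ (by fun_prop), one_smul]
  | succ n ih =>
    change k x = ∫⁻ g, k (g • x) ∂(Measure.mconv μ (convPow μ n))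
    rw [Measure.lintegral_mconv (by fun_prop), lintegral_lintegral_swap
      (Measurable.aemeasurable (by fun_prop)), ih]
    refine lintegral_congr fun b => ?_
    simp_rw [mul_smul]
    exact hharm _

end ConvolutionPowers

/-! ### Almost-everywhere stabilizers and the averaging operator -/

section InvariantMeasure

variable {G X : Type*} [Group G] [MeasurableSpace G] [MulAction G X] [MeasurableSpace X]
  [MeasurableSMul₂ G X] {m : Measure X} [SMulInvariantMeasure G X m]

/-- The subgroup of elements that fix a measurable function up to a null set. -/
def aeStabilizer (m : Measure X) [SMulInvariantMeasure G X m] (f : X → ℝ) : Subgroup G where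
  carrier := {g | ∀ᵐ x ∂m, f (g • x) = f x}
  one_mem' := by simp
  mul_mem' := fun {a b} ha hb => by
    have := (measurePreserving_smul b m).quasiMeasurePreserving.ae ha
    change ∀ᵐ x ∂m, f ((a * b) • x) = f x
    filter_upwards [this, hb] with x h1 h2
    rw [mul_smul, h1, h2]
  inv_mem' := fun {a} ha => by
    have := (measurePreserving_smul a⁻¹ m).quasiMeasurePreserving.ae ha
    change ∀ᵐ x ∂m, f (a⁻¹ • x) = f x
    filter_upwards [this] with x h1
    rw [smul_inv_smul] at h1
    exact h1.symm

variable [SigmaFinite m]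

theorem measurableSet_aeStabilizer {f : X → ℝ} (hf : Measurable f) :
    MeasurableSet (aeStabilizer (G := G) m f : Set G) := by
  have h : MeasurableSet {p : X × G | f (p.2 • p.1) ≠ f p.1} :=
    (measurableSet_eq_fun (by fun_prop) (by fun_prop)).compl
  exact measurable_measure_prodMk_right (μ := m) h (measurableSet_singleton 0)

theorem ae_lintegral_smul_eq_zero {μ : Measure G} [SFinite μ] {q : X → ℝ≥0∞} (hq : Measurable q) (h : q =ᵐ[m] 0) :
    (fun x => ∫⁻ g, q (g • x) ∂μ) =ᵐ[m] 0 := by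
  have hm : Measurable fun p : X × G => q (p.2 • p.1) := by fun_prop
  rw [← lintegral_eq_zero_iff hm.lintegral_prod_right',
    ← lintegral_prod (fun p : X × G => q (p.2 • p.1)) hm.aemeasurable, lintegral_prod_symm' _ hm]
  have h1 : ∀ g : G, ∫⁻ x, q (g • x) ∂m = 0 := fun g => by
    rw [(measurePreserving_smul g m).lintegral_comp hq, (lintegral_eq_zero_iff hq).2 h]
  simp [h1]

end InvariantMeasure

/-! ### Consequences of spread-outness, and recurrence -/

section SpreadOut

variable {G X : Type*} [Group G] [TopologicalSpace G] [IsTopologicalGroup G]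
  [LocallyCompactSpace G] [SecondCountableTopology G] [MeasurableSpace G] [BorelSpace G]
  [MulAction G X] [MeasurableSpace X] [MeasurableSMul₂ G X] [MulAction.IsPretransitive G X]
  {m : Measure X} [SigmaFinite m] [SMulInvariantMeasure G X m]
  {μ : Measure G} [IsProbabilityMeasure μ]

/-- A bounded harmonic function of a spread out walk that vanishes almost everywhere vanishes. -/
theorem harmonic_eq_zero_of_ae (hm : m ≠ 0) (hspread : IsSpreadOut μ) {k : X → ℝ≥0∞}
    (hk : Measurable k) (hk1 : ∀ x, k x ≤ 1) (hharm : ∀ x, k x = ∫⁻ g, k (g • x) ∂μ)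
    (h0 : k =ᵐ[m] 0) (x : X) : k x = 0 := by
  obtain ⟨n, -, hn⟩ := hspread
  -- The absolutely continuous part `a` does not see `k`, which vanishes Haar-almost everywhere
  -- along every orbit. Only `s`, of mass less than 1, contributes, so the finite supremum of `k` is
  -- contracted and must be 0.
  set s := (convPow μ n).singularPart (Measure.haar : Measure G) with hs
  set a := (Measure.haar : Measure G).withDensity
    ((convPow μ n).rnDeriv (Measure.haar : Measure G)) with ha
  have hdec : convPow μ n = s + a := Measure.haveLebesgueDecomposition_add _ _
  have hsum : s Set.univ + a Set.univ = 1 := by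
    rw [← Measure.add_apply, ← hdec, measure_univ]
  have hs1 : s Set.univ < 1 := by
    have ha0 : a Set.univ ≠ 0 := fun h => hn <| by
      rw [hdec, Measure.measure_univ_eq_zero.1 h, add_zero]
      exact Measure.mutuallySingular_singularPart _ _
    have hst : s Set.univ ≠ ∞ := fun h => by simp [h] at hsum
    rw [← hsum]
    exact ENNReal.lt_add_right hst ha0
  have hstep : ∀ x, k x ≤ (⨆ y, k y) * s Set.univ := fun x => by
    have hN : (Measure.haar : Measure G) {g : G | g • x ∈ {y | k y ≠ 0}} = 0 :=
      (haar_preimage_smul_eq_zero_iff hm (hk (measurableSet_singleton 0)).compl x).2 h0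
    have haz : ∫⁻ g, k (g • x) ∂a = 0 := by
      rw [lintegral_eq_zero_iff (by fun_prop)]
      exact withDensity_absolutelyContinuous _ _ hN
    rw [lintegral_convPow_of_harmonic hk hharm n x, hdec, lintegral_add_measure, haz, add_zero,
      ← lintegral_const]
    exact lintegral_mono fun g => le_iSup k (g • x)
  have hsup : (⨆ y, k y) ≤ (⨆ y, k y) * s Set.univ := iSup_le hstep
  have hfin : (⨆ y, k y) ≠ ∞ := ne_top_of_le_ne_top ENNReal.one_ne_top (iSup_le hk1)
  have hzero : (⨆ y, k y) = 0 := by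
    by_contra hne
    have := ENNReal.mul_lt_mul_right hne hfin hs1
    rw [mul_one] at this
    exact absurd hsup (not_le.2 this)
  exact le_antisymm ((le_iSup k x).trans hzero.le) zero_le

-- The stabilizer carries every convolution power of `μ`, so it cannot be Haar-null when one of them
-- is not singular. By Steinhaus it is then open, hence closed, and it contains the support of `μ`.
omit [MulAction.IsPretransitive G X] in
theorem aeStabilizer_eq_top (hadapted : IsAdapted μ) (hspread : IsSpreadOut μ) {f : X → ℝ}
    (hf : Measurable f) (hinv : ∀ᵐ p ∂(m.prod μ), f (p.2 • p.1) = f p.1) :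
    aeStabilizer (G := G) m f = ⊤ := by
  set S := aeStabilizer (G := G) m f with hS
  have hSm : MeasurableSet (S : Set G) := measurableSet_aeStabilizer hf
  have hμS : ∀ᵐ g ∂μ, g ∈ S := by
    have h : MeasurableSet {p : X × G | f (p.2 • p.1) ≠ f p.1} :=
      (measurableSet_eq_fun (by fun_prop) (by fun_prop)).compl
    have h2 : (m.prod μ) {p : X × G | f (p.2 • p.1) ≠ f p.1} = 0 := hinv
    rw [Measure.prod_apply_symm h, lintegral_eq_zero_iff (measurable_measure_prodMk_right h)] at h2
    exact h2
  have hpos : 0 < (Measure.haar : Measure G) S := by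
    obtain ⟨n, -, hn⟩ := hspread
    refine pos_iff_ne_zero.2 fun h => hn ⟨(S : Set G)ᶜ, hSm.compl, ae_mem_convPow hSm hμS n, ?_⟩
    rwa [compl_compl]
  have hopen : IsOpen (S : Set G) := by
    refine S.isOpen_of_mem_nhds (g := 1) (mem_of_superset
      (Measure.div_mem_nhds_one_of_haar_pos Measure.haar _ hSm hpos) ?_)
    rintro _ ⟨a, ha, b, hb, rfl⟩
    exact S.div_mem ha hb
  have hclosed := S.isClosed_of_isOpen hopen
  have hsupp : μ.support ⊆ S := Measure.support_subset_of_isClosed hclosed hμS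
  rw [eq_top_iff, ← show _ = ⊤ from hadapted]
  exact Subgroup.topologicalClosure_minimal _ ((Subgroup.closure_le S).2 hsupp) hclosed

/-- Fubini against Haar measure exchanges the quantifiers: some `x` has `f (g • x) = f x` for almost
every `g`, and its orbit is all of `X`. -/
theorem ae_eq_const_of_aeStabilizer_eq_top (hm : m ≠ 0) {f : X → ℝ} (hf : Measurable f)
    (h : aeStabilizer (G := G) m f = ⊤) : ∃ c, ∀ᵐ x ∂m, f x = c := by
  have hinv : ∀ g : G, ∀ᵐ x ∂m, f (g • x) = f x := fun g =>
    (h ▸ Subgroup.mem_top g : g ∈ aeStabilizer (G := G) m f)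
  have hmeas : MeasurableSet {p : X × G | f (p.2 • p.1) ≠ f p.1} :=
    (measurableSet_eq_fun (by fun_prop) (by fun_prop)).compl
  have hprod : ∀ᵐ p ∂(m.prod (Measure.haar : Measure G)), f (p.2 • p.1) = f p.1 := by
    change (m.prod (Measure.haar : Measure G)) {p : X × G | f (p.2 • p.1) ≠ f p.1} = 0
    rw [Measure.prod_apply_symm hmeas, lintegral_eq_zero_iff (measurable_measure_prodMk_right hmeas)]
    exact Eventually.of_forall hinv
  have : (ae m).NeBot := ae_neBot.2 hm
  obtain ⟨x, hx⟩ := (Measure.ae_ae_of_ae_prod hprod).exists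
  exact ⟨f x, (haar_preimage_smul_eq_zero_iff hm
    (hf (measurableSet_singleton (f x))).compl x).1 hx⟩

variable [TopologicalSpace X] [BorelSpace X]

/-- A walk of at most quadratic growth hits every nonempty open set, from almost every point. -/
theorem avoidProb_zero_ae_eq_zero (hm : m ≠ 0)
    (hcont : ∀ x : X, Continuous fun g : G => g • x)
    (hopen : ∀ x : X, IsOpenMap fun g : G => g • x) (hgrowth : HasPolynomialGrowth G m 2)
    (hadapted : IsAdapted μ) (hsymm : IsSymmetric μ) (hspread : IsSpreadOut μ)
    (hcompact : IsCompact μ.support) {B : Set X} (hB : IsOpen B) (hne : B.Nonempty) :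
    ∀ᵐ x ∂m, avoidProb μ B 0 x = 0 := by
  set q := avoidProb μ B 0 with hq
  have hqm : Measurable q := measurable_avoidProb μ hB.measurableSet 0
  have hq1 : ∀ x, q x ≤ 1 := avoidProb_le_one μ 0
  have hqt : ∀ x, q x ≠ ∞ := fun x => ne_top_of_le_ne_top ENNReal.one_ne_top (hq1 x)
  have hqr : ∀ x, (q x).toReal ≤ 1 := fun x => ENNReal.toReal_le_of_le_ofReal zero_le_one
    (by simpa using hq1 x)
  -- The constant 2 keeps `f ≥ 1`, as the Hardy inequality divides by `f`.
  set f : X → ℝ := fun x => 2 - (q x).toReal with hf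
  have hfm : Measurable f := by fun_prop
  have hfq : ∀ x, ENNReal.ofReal (f x) + q x = 2 := fun x => by
    conv_lhs => rw [← ENNReal.ofReal_toReal (hqt x)]
    rw [← ENNReal.ofReal_add (by simp only [hf]; linarith [hqr x]) ENNReal.toReal_nonneg]
    simp [hf]
  have hP : ∀ x, ∫⁻ g, ENNReal.ofReal (f (g • x)) ∂μ ≤ ENNReal.ofReal (f x) := fun x => by
    have h1 : q x ≤ ∫⁻ g, q (g • x) ∂μ := by
      rw [hq, ← avoidProb_succ μ hB.measurableSet 0 x]
      exact avoidProb_mono μ x zero_le_one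
    have h2 : ∫⁻ g, ENNReal.ofReal (f (g • x)) ∂μ + ∫⁻ g, q (g • x) ∂μ = 2 := by
      rw [← lintegral_add_left (by fun_prop)]
      simp [hfq]
    refine (ENNReal.add_le_add_iff_right (hqt x)).1 ?_
    rw [hfq, ← h2]
    gcongr
  obtain ⟨d, C, hd, hC, hball, hstep⟩ := exists_wordDistance hopen hgrowth hcompact
  have hstep' : ∀ᵐ g ∂μ, ∀ x, d x ≤ d (g • x) + 1 ∧ d (g • x) ≤ d x + 1 := by
    filter_upwards [Measure.support_mem_ae] with g hg
    exact hstep g hg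
  have hinv : ∀ᵐ p ∂(m.prod μ), f (p.2 • p.1) = f p.1 :=
    ae_smul_eq_of_superharmonic hsymm hfm (fun x => by simp only [hf]; linarith [hqr x]) hP
      (u := fun N x => logCutoff N (d x))
      (fun N => (measurable_from_top (f := logCutoff N)).comp hd)
      (fun N x => logCutoff_nonneg N _) (lintegral_logCutoff_sq_ne_top hd hball)
      (fun x => tendsto_logCutoff _) (tendsto_energy_logCutoff hd hC hball hstep')
  obtain ⟨c, hc⟩ := ae_eq_const_of_aeStabilizer_eq_top hm hfm
    (aeStabilizer_eq_top hadapted hspread hfm hinv)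
  -- On `B` the function `f` equals 2, and `B` is not null because its preimage under an orbit map
  -- is open and nonempty.
  have hc2 : c = 2 := by
    by_contra hne2
    obtain ⟨x, hx⟩ := hne
    have hB0 : m B = 0 := measure_mono_null (fun y hy => by
      change ¬ f y = c
      rw [hf]
      simp only [hq, avoidProb_zero_of_mem μ hy]
      simpa using Ne.symm hne2) hc
    have h0 := (haar_preimage_smul_eq_zero_iff (G := G) hm hB.measurableSet x).2 hB0
    exact ((hB.preimage (hcont x)).measure_pos Measure.haar ⟨1, by simpa using hx⟩).ne' h0
  filter_upwards [hc] with x hx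
  have h1 : (q x).toReal = 0 := by
    simp only [hf, hc2] at hx
    linarith
  exact ((ENNReal.toReal_eq_zero_iff _).1 h1).resolve_right (hqt x)

theorem isTopHarrisRecurrentAt_of_quadraticGrowth (hm : m ≠ 0)
    (hcont : ∀ x : X, Continuous fun g : G => g • x)
    (hopen : ∀ x : X, IsOpenMap fun g : G => g • x) (hgrowth : HasPolynomialGrowth G m 2)
    (hadapted : IsAdapted μ) (hsymm : IsSymmetric μ) (hspread : IsSpreadOut μ)
    (hcompact : IsCompact μ.support) (x : X) : IsTopHarrisRecurrentAt μ x := by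
  intro B hB
  have hI : IsOpen (interior B) := isOpen_interior
  have hIm := hI.measurableSet
  -- Averaging over one step preserves vanishing almost everywhere, since `m` is invariant.
  have havoid : ∀ n, avoidProb μ (interior B) n =ᵐ[m] 0 := fun n => by
    induction n with
    | zero =>
      exact avoidProb_zero_ae_eq_zero hm hcont hopen hgrowth hadapted hsymm hspread hcompact hI
        ⟨x, mem_interior_iff_mem_nhds.2 hB⟩
    | succ n ih =>
      have := ae_lintegral_smul_eq_zero (μ := μ) (measurable_avoidProb μ hIm n) ih
      simpa only [← avoidProb_succ μ hIm n] using this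
  have hescape : escapeProb μ (interior B) =ᵐ[m] 0 := by
    filter_upwards [ae_all_iff.2 havoid] with y hy
    refine le_antisymm ((escapeProb_le_tsum μ y).trans (le_of_eq ?_)) zero_le
    simp [hy]
  have h0 := harmonic_eq_zero_of_ae hm hspread (measurable_escapeProb μ hIm)
    (escapeProb_le_one μ) (escapeProb_eq_lintegral μ hIm) hescape x
  have hae : ∀ᵐ Y ∂(Measure.infinitePi fun _ : ℕ => μ), ∃ᶠ n in atTop, walk x Y n ∈ interior B :=
    h0
  filter_upwards [hae] with Y hY
  exact hY.mono fun n hn => interior_subset hn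

end SpreadOut

end HomogeneousWalk

theorem mainTheorem3 {G : Type*} [Group G] [TopologicalSpace G] [IsTopologicalGroup G]
    [LocallyCompactSpace G] [SigmaCompactSpace G] [TopologicalSpace.MetrizableSpace G]
    [MeasurableSpace G] [BorelSpace G] (Γ : Subgroup G) [DiscreteTopology Γ]
    (m : Measure (G ⧸ Γ)) (hm : HomogeneousWalk.IsHaarOn G m)
    (hgrowth : HomogeneousWalk.HasPolynomialGrowth G m 2)
    (μ : Measure G) [IsProbabilityMeasure μ]
    (hadapted : HomogeneousWalk.IsAdapted μ) (hsymm : HomogeneousWalk.IsSymmetric μ)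
    (hspread : HomogeneousWalk.IsSpreadOut μ) (hcompact : IsCompact μ.support) :
    HomogeneousWalk.IsTopHarrisRecurrent (G ⧸ Γ) μ := by
  have : BorelSpace (G ⧸ Γ) := HomogeneousWalk.borelSpace_quotient Γ
  have : SecondCountableTopology G := by
    let _ := TopologicalSpace.metrizableSpaceMetric G
    exact EMetric.secondCountable_of_sigmaCompact G
  -- With regularity this makes `m` σ-finite, as the Fubini arguments require.
  have : SigmaCompactSpace (G ⧸ Γ) := by
    rw [← isSigmaCompact_univ_iff, ← QuotientGroup.mk_surjective.range_eq]
    exact isSigmaCompact_range QuotientGroup.continuous_mk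
  have := hm.regular
  have := hm.invariant
  have hopen : ∀ x : G ⧸ Γ, IsOpenMap fun g : G => g • x := fun x => by
    obtain ⟨a, rfl⟩ := QuotientGroup.mk_surjective x
    exact QuotientGroup.isOpenMap_coe.comp (isOpenMap_mul_right a)
  exact fun x => HomogeneousWalk.isTopHarrisRecurrentAt_of_quadraticGrowth hm.ne_zero
    (fun x => by fun_prop) hopen hgrowth hadapted hsymm hspread hcompact x
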